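/- Consider a random sample $\mathcal S$ of $|\mathcal S|$ units, unit $i$ having an outcome $Y_i\in\mathbb R$, controls $X_i\in\mathbb R^p$ and a treatment indicator $D_i\in\{0,1\}$. Let $F$ be the conditional distribution of $Y$ given $(X,D)$, let $\mathcal S^*\subseteq\mathcal S$ be a subsample, and let $s:\mathbb R^p\to\mathbb R^q$ be a covariate function, with $p,q$ fixed; each of $F$, $\mathcal S^*$ and $s$ may depend on $W_{\mathcal S}:=\{(X_i,D_i)\}_{i\in\mathcal S}$ (but not on the outcomes). Given $W_{\mathcal S}$, the outcomes are independent and $Y_i$ has distribution $F(\cdot\mid X_i,D_i)$. Put $Z=(1,D,s(X)')'$, $Z_i=(1,D_i,s(X_i)')'$, $U=Y-\mathbb E_F[Y\mid X,D]$, and $$\hat\theta^*=\Bigl(\tfrac1{|\mathcal S^*|}\sum_{i\in\mathcal S^*}Z_iZ_i'\Bigr)^{-1}\tfrac1{|\mathcal S^*|}\sum_{i\in\mathcal S^*}Z_iY_i,\qquad \theta_{\mathbb G^*,F}=\Bigl(\tfrac1{|\mathcal S^*|}\sum_{i\in\mathcal S^*}Z_iZ_i'\Bigr)^{-1}\tfrac1{|\mathcal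 S^*|}\sum_{i\in\mathcal S^*}Z_i\,\mathbb E_F[Y\mid X=X_i,D=D_i],$$ $$\Gamma^*=\tfrac1{|\mathcal S^*|}\sum_{i\in\mathcal S^*}Z_iZ_i',\qquad \Delta^*=\tfrac1{|\mathcal S^*|}\sum_{i\in\mathcal S^*}Z_iZ_i'\,\mathbb E_F[U^2\mid X=X_i,D=D_i],\qquad \Sigma^*=(\Gamma^*)^{-1}\Delta^*(\Gamma^*)^{-1}.$$ Fix, for each sample, a realization $\{(x_i,d_i)\}_{i\in\mathcal S}$ of $W_{\mathcal S}$, and suppose that, given $W_{\mathcal S}=\{(x_i,d_i)\}_{i\in\mathcal S}$: 1. $|\mathcal S^*|\to\infty$ as $|\mathcal S|\to\infty$; 2. $\liminf_{|\mathcal S|\to\infty}\lambda_{\min}[\Gamma^*]\ge\underline\lambda$ and $\liminf_{|\mathcal S|\to\infty}\lambda_{\min}[\Delta^*]\ge\underline\lambda$ for some constant $\underline\lambda>0$, where $\lambda_{\min}$ denotes the smallest eigenvalue; 3. for some $\delta>0$ and some constant $M>0$ not depending on $\mathcal S$, and for each $d\in\{0,1\}$, $\mathbb E_F[\|ZU\|^{2+\delta}\mid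 X=x,D=d]\le M$ for all $x\in\{X_i:i\in\mathcal S^*,\,D_i=d\}$. Then $\Sigma^{*-1/2}\sqrt{|\mathcal S^*|}\,(\hat\theta^*-\theta_{\mathbb G^*,F})$ converges in conditional distribution to $\mathcal N(\mathbf 0,I)$ given $W_{\mathcal S}=\{(x_i,d_i)\}_{i\in\mathcal S}$: if $\mathcal L$ denotes its conditional law given $W_{\mathcal S}=\{(x_i,d_i)\}_{i\in\mathcal S}$ and $\rho$ the Lévy–Prokhorov metric on the probability measures on $\mathbb R^{q+2}$, then $\rho(\mathcal L,\mathcal N(\mathbf 0,I))\to0$ as $|\mathcal S|\to\infty$. -/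

import Mathlib

open MeasureTheory ProbabilityTheory Filter Topology
open scoped Matrix ENNReal

noncomputable section

/-- The controls and the treatment status `(x, d)` of one unit, in `ℝᵖ × {0, 1}`. -/
abbrev UnitDesign (p : ℕ) : Type := (Fin p → ℝ) × Fin 2

/-- The controls and treatment statuses `{(xᵢ, dᵢ)}` of all `n` units of a sample. -/
abbrev Design (p n : ℕ) : Type := Fin n → UnitDesign p

/-- A sample of `n` units together with its analysis. Everything below may depend on the observed
controls and treatment statuses of the whole sample, but not on the outcomes.
* `F (w, (x, d))` is the conditional distribution of the outcome of a unit given that its controls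
  and treatment status are `(x, d)`, when those of the whole sample are `w`;
* `subsample w` is the selected subsample;
* `covariates w` is the function mapping controls to regression covariates. -/
structure Study (p q n : ℕ) where
  F : Kernel (Design p n × UnitDesign p) ℝ
  isMarkovKernel_F : IsMarkovKernel F
  subsample : Design p n → Finset (Fin n)
  covariates : Design p n → (Fin p → ℝ) → (Fin q → ℝ)

namespace Study

variable {p q n : ℕ}

instance instIsMarkovKernelF (E : Study p q n) : IsMarkovKernel E.F := E.isMarkovKernel_F

theorem measurable_pi_F (E : Study p q n) :
    Measurable fun w : Design p n => Measure.pi fun i => E.F (w, w i) := by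
  refine Measurable.measure_of_isPiSystem_of_isProbabilityMeasure generateFrom_pi.symm
    isPiSystem_pi ?_
  rintro _ ⟨t, ht, rfl⟩
  simp only [Measure.pi_pi]
  refine Finset.measurable_prod _ fun i _ => ?_
  exact (E.F.measurable_coe (ht i (Set.mem_univ i))).comp (by fun_prop)

/-- The conditional distribution of the outcomes `(Y₁, …, Yₙ)` given the controls and treatment
statuses `w` of a random sample: the outcomes are independent, and that of unit `i` has
distribution `F (w, (xᵢ, dᵢ))`. -/
def outcomeKernel (E : Study p q n) : Kernel (Design p n) (Fin n → ℝ) where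
  toFun w := Measure.pi fun i => E.F (w, w i)
  measurable' := E.measurable_pi_F

instance instIsMarkovKernelOutcomeKernel (E : Study p q n) : IsMarkovKernel E.outcomeKernel :=
  ⟨fun w => inferInstanceAs (IsProbabilityMeasure (Measure.pi fun i => E.F (w, w i)))⟩

/-- The conditional distribution, given the controls and treatment statuses `w`, of a statistic `T`
of the sample. -/
def condLaw (E : Study p q n) {V : Type*} [MeasurableSpace V]
    (T : Design p n → (Fin n → ℝ) → V) (w : Design p n) : Measure V :=
  (E.outcomeKernel w).map (T w)

/-- For random variables with the conditional distribution above, `condLaw` is a regular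
conditional distribution of the statistic. -/
theorem condDistrib_ae_eq_condLaw (E : Study p q n) {Ω : Type*} [MeasurableSpace Ω]
    {P : Measure Ω} [IsProbabilityMeasure P] {W : Ω → Design p n} {Y : Ω → Fin n → ℝ}
    (hWY : HasCondDistrib Y W E.outcomeKernel P)
    {V : Type*} [MeasurableSpace V] [StandardBorelSpace V] [Nonempty V]
    {T : Design p n → (Fin n → ℝ) → V} (hT : Measurable (Function.uncurry T)) :
    condDistrib (fun ω => T (W ω) (Y ω)) W P =ᵐ[P.map W] E.condLaw T := by
  have hW := hWY.aemeasurable_fst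
  have hY := hWY.aemeasurable_snd
  have hη : ∀ w, ((Kernel.id ×ₖ E.outcomeKernel).map (Function.uncurry T)) w = E.condLaw T w := by
    intro w
    rw [Kernel.map_apply _ hT, Kernel.prod_apply, Kernel.id_apply, Measure.dirac_prod,
      Measure.map_map hT (by fun_prop)]
    rfl
  have : condDistrib (fun ω => T (W ω) (Y ω)) W P =ᵐ[P.map W]
      (Kernel.id ×ₖ E.outcomeKernel).map (Function.uncurry T) := by
    have hTW : AEMeasurable (fun ω => T (W ω) (Y ω)) P := hT.comp_aemeasurable (hW.prodMk hY)
    have hIM := Kernel.IsMarkovKernel.map (Kernel.id ×ₖ E.outcomeKernel) hT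
    refine condDistrib_ae_eq_of_measure_eq_compProd W hTW ?_
    have hg : Measurable fun z : Design p n × (Fin n → ℝ) => (z.1, Function.uncurry T z) := by
      fun_prop
    have h1 : P.map (fun ω => (W ω, T (W ω) (Y ω))) =
        (P.map fun ω => (W ω, Y ω)).map fun z => (z.1, Function.uncurry T z) := by
      rw [AEMeasurable.map_map_of_aemeasurable hg.aemeasurable (hW.prodMk hY)]
      rfl
    have : IsProbabilityMeasure (P.map W) := Measure.isProbabilityMeasure_map hW
    rw [h1, hWY.map_eq]
    ext s hs
    rw [Measure.map_apply hg hs, Measure.compProd_apply (hg hs), Measure.compProd_apply hs]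
    refine lintegral_congr fun w => ?_
    have hTw : Measurable (T w) := hT.comp measurable_prodMk_left
    rw [hη w, condLaw, Measure.map_apply hTw (measurable_prodMk_left hs)]
    rfl
  filter_upwards [this] with w hw
  rw [hw, hη w]

/-- The regressors `z = (1, d, s(x)')'` of a unit with controls and treatment status `(x, d)`. -/
def regressors (E : Study p q n) (w : Design p n) (c : UnitDesign p) :
    EuclideanSpace ℝ (Fin (q + 2)) :=
  WithLp.toLp 2 (Matrix.vecCons 1 (Matrix.vecCons (c.2.val : ℝ) (E.covariates w c.1)))

/-- The outer product `z z'`. -/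
def outerSq {m : ℕ} (z : EuclideanSpace ℝ (Fin m)) : Matrix (Fin m) (Fin m) ℝ :=
  Matrix.vecMulVec (WithLp.ofLp z) (WithLp.ofLp z)

/-- The conditional mean `E_F[Y | (X, D) = c]` of the outcome. -/
def condMean (E : Study p q n) (w : Design p n) (c : UnitDesign p) : ℝ :=
  ∫ y, y ∂(E.F (w, c))

/-- The conditional second moment `E_F[U² | (X, D) = c]` of `U = Y - E_F[Y | X, D]`. -/
def condVar (E : Study p q n) (w : Design p n) (c : UnitDesign p) : ℝ :=
  ∫ y, (y - E.condMean w c) ^ 2 ∂(E.F (w, c))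

/-- The conditional moment `E_F[‖Z U‖ ^ r | (X, D) = c]`, as an extended nonnegative number.
As `‖Z‖ ≥ 1`, its finiteness for some `r ≥ 1` implies that `Y` is conditionally integrable. -/
def condMoment (E : Study p q n) (r : ℝ) (w : Design p n) (c : UnitDesign p) : ℝ≥0∞ :=
  ∫⁻ y, ‖(y - E.condMean w c) • E.regressors w c‖ₑ ^ r ∂(E.F (w, c))

/-- `𝕏*ᵈ`, the set of the controls of the units of the subsample with treatment status `d`. -/
def subsampleSupport (E : Study p q n) (w : Design p n) (d : Fin 2) : Set (Fin p → ℝ) :=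
  {x | ∃ i ∈ E.subsample w, (w i).2 = d ∧ (w i).1 = x}

/-- `Γ* = |S*|⁻¹ ∑_{i ∈ S*} Zᵢ Zᵢ'`. -/
def gammaStar (E : Study p q n) (w : Design p n) : Matrix (Fin (q + 2)) (Fin (q + 2)) ℝ :=
  ((E.subsample w).card : ℝ)⁻¹ • ∑ i ∈ E.subsample w, outerSq (E.regressors w (w i))

/-- `Δ* = |S*|⁻¹ ∑_{i ∈ S*} Zᵢ Zᵢ' E_F[U² | X = Xᵢ, D = Dᵢ]`. -/
def deltaStar (E : Study p q n) (w : Design p n) : Matrix (Fin (q + 2)) (Fin (q + 2)) ℝ :=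
  ((E.subsample w).card : ℝ)⁻¹ •
    ∑ i ∈ E.subsample w, E.condVar w (w i) • outerSq (E.regressors w (w i))

/-- `Σ* = (Γ*)⁻¹ Δ* (Γ*)⁻¹`. -/
def sigmaStar (E : Study p q n) (w : Design p n) : Matrix (Fin (q + 2)) (Fin (q + 2)) ℝ :=
  (E.gammaStar w)⁻¹ * E.deltaStar w * (E.gammaStar w)⁻¹

/-- The coefficients `(|S*|⁻¹ ∑ Zᵢ Zᵢ')⁻¹ (|S*|⁻¹ ∑ Zᵢ vᵢ)` (sums over `i ∈ S*`) of the least squares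
regression of `vᵢ` on `Zᵢ` within the subsample. -/
def leastSquares (E : Study p q n) (w : Design p n) (v : Fin n → ℝ) : Fin (q + 2) → ℝ :=
  (E.gammaStar w)⁻¹ *ᵥ
    (((E.subsample w).card : ℝ)⁻¹ •
      ∑ i ∈ E.subsample w, v i • WithLp.ofLp (E.regressors w (w i)))

/-- The least squares estimator, for outcomes `y`. -/
def thetaHat (E : Study p q n) (w : Design p n) (y : Fin n → ℝ) : Fin (q + 2) → ℝ :=
  E.leastSquares w y

/-- The estimand: the regression coefficients of the conditional means of the outcomes. -/
def thetaF (E : Study p q n) (w : Design p n) : Fin (q + 2) → ℝ :=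
  E.leastSquares w fun i => E.condMean w (w i)

/-- The inverse square root of a symmetric positive definite matrix, by functional calculus. -/
def invSqrt {m : ℕ} (A : Matrix (Fin m) (Fin m) ℝ) : Matrix (Fin m) (Fin m) ℝ :=
  cfc (fun t : ℝ => (Real.sqrt t)⁻¹) A

/-- The statistic `Σ*^{-1/2} √|S*| (θ̂* - θ_{𝔾*,F})`. -/
def normalizedError (E : Study p q n) (w : Design p n) (y : Fin n → ℝ) :
    EuclideanSpace ℝ (Fin (q + 2)) :=
  WithLp.toLp 2 (invSqrt (E.sigmaStar w) *ᵥ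
    (Real.sqrt ((E.subsample w).card : ℝ) • (E.thetaHat w y - E.thetaF w)))

/-- The smallest eigenvalue of a symmetric matrix. -/
def lambdaMin {m : ℕ} (A : Matrix (Fin m) (Fin m) ℝ) : ℝ :=
  sInf (spectrum ℝ A)

end Study

end

/-!
Conditionally on the design, `θ̂* - θ_{𝔾*,F}` is `Γ*⁻¹` applied to the mean over the subsample of the
independent centered scores `Zᵢ Uᵢ`. Along a vector `t`, the normalized error is therefore a sum of
independent centered variables `cᵢ Uᵢ` (`Study.inner_normalizedError`), where `cᵢ` is
`|S*|^{-1/2} ⟨Zᵢ, b⟩` with `b = Γ*⁻¹ Σ*^{-1/2} t`. Two facts make Lyapunov's central limit theorem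
applicable, uniformly in the design:

* the variances add up to `b' Δ* b = t' Σ*^{-1/2} Σ* Σ*^{-1/2} t = ‖t‖²`
  (`Study.scoreDirection_dotProduct_deltaStar`);
* hence `λ_min(Δ*) ‖b‖² ≤ ‖t‖²`, so that `b` is bounded, and since `|cᵢ Uᵢ|` is at most
  `|S*|^{-1/2} ‖b‖ ‖Zᵢ Uᵢ‖`, the moments of order `2 + δ` add up to `O(|S*|^{-δ/2})`
  (`Study.sum_integral_abs_rpow_le`). The matrix `Γ*` enters only through its invertibility.

The laws change with the sample size, so the central limit theorem is proved as an explicit bound on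
characteristic functions (`norm_integral_exp_sum_sub_gaussian_le`): each factor of the
characteristic function is compared with the Gaussian factor of the same variance by a second order
expansion whose remainder is truncated at a level `ε`. The pointwise limit `exp (-‖t‖² / 2)` gives
weak convergence by Lévy's theorem, and the Lévy–Prokhorov distance metrizes it.
-/

/-! ### A quantitative Lyapunov central limit theorem -/

/-- A product of numbers in the closed unit disc is a `1`-Lipschitz function of its factors, for the
`ℓ¹` norm. -/
theorem norm_prod_sub_prod_le_sum {ι : Type*} (s : Finset ι) (a b : ι → ℂ)
    (ha : ∀ i, ‖a i‖ ≤ 1) (hb : ∀ i, ‖b i‖ ≤ 1) :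
    ‖∏ i ∈ s, a i - ∏ i ∈ s, b i‖ ≤ ∑ i ∈ s, ‖a i - b i‖ := by
  classical
  induction s using Finset.induction_on with
  | empty => simp
  | insert j s hj ih =>
    rw [Finset.prod_insert hj, Finset.prod_insert hj, Finset.sum_insert hj]
    have h : a j * ∏ i ∈ s, a i - b j * ∏ i ∈ s, b i =
        (a j - b j) * ∏ i ∈ s, a i + b j * (∏ i ∈ s, a i - ∏ i ∈ s, b i) := by ring
    have hprod : ‖∏ i ∈ s, a i‖ ≤ 1 := by
      rw [norm_prod]
      exact Finset.prod_le_one (fun _ _ => norm_nonneg _) fun i _ => ha i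
    rw [h]
    refine (norm_add_le _ _).trans (add_le_add ?_ ?_)
    · rw [norm_mul]
      exact mul_le_of_le_one_right (norm_nonneg _) hprod
    · rw [norm_mul]
      exact (mul_le_of_le_one_left (norm_nonneg _) (hb j)).trans ih

/-- Truncation: the part of a square above level `ε` is controlled by a higher moment. -/
theorem sq_le_rpow_of_lt_abs {ε δ x : ℝ} (hε : 0 < ε) (hδ : 0 < δ) (hx : ε < |x|) :
    x ^ 2 ≤ ε ^ (-δ) * |x| ^ (2 + δ) := by
  have hx0 : 0 < |x| := hε.trans hx
  rw [Real.rpow_add hx0, Real.rpow_two, sq_abs, Real.rpow_neg hε.le]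
  have h : 1 ≤ (ε ^ δ)⁻¹ * |x| ^ δ := by
    rw [inv_mul_eq_div, one_le_div (by positivity)]
    exact Real.rpow_le_rpow hε.le hx.le hδ.le
  nlinarith [sq_nonneg x]

theorem sq_le_sq_add_rpow {ε δ : ℝ} (x : ℝ) (hε : 0 < ε) (hδ : 0 < δ) :
    x ^ 2 ≤ ε ^ 2 + ε ^ (-δ) * |x| ^ (2 + δ) := by
  rcases le_or_gt |x| ε with h | h
  · have : 0 ≤ ε ^ (-δ) * |x| ^ (2 + δ) := by positivity
    nlinarith [sq_le_sq' (abs_le.1 h).1 (abs_le.1 h).2]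
  · nlinarith [sq_le_rpow_of_lt_abs hε hδ h]

/-- Second order Taylor expansion of the character `x ↦ exp (i x)`, with a remainder that is a small
multiple of `x ^ 2` up to a term that only sees large `x`. -/
theorem norm_exp_mul_I_sub_taylor_le {ε δ : ℝ} (x : ℝ) (hε : 0 < ε) (hε1 : ε ≤ 1) (hδ : 0 < δ) :
    ‖Complex.exp (x * Complex.I) - (1 + x * Complex.I - x ^ 2 / 2)‖ ≤
      ε * x ^ 2 + 4 * (ε ^ (-δ) * |x| ^ (2 + δ)) := by
  have hsmall : |x| ≤ 1 →
      ‖Complex.exp (x * Complex.I) - (1 + x * Complex.I - x ^ 2 / 2)‖ ≤ |x| ^ 3 := by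
    intro hx
    have hn : ‖(x * Complex.I : ℂ)‖ = |x| := by simp
    have h := Complex.exp_bound (x := x * Complex.I) (by rwa [hn]) (n := 3) (by norm_num)
    rw [hn] at h
    have hsum : ∑ m ∈ Finset.range 3, (x * Complex.I : ℂ) ^ m / m.factorial =
        1 + x * Complex.I - x ^ 2 / 2 := by
      simp only [Finset.sum_range_succ, Finset.sum_range_zero, mul_pow, Complex.I_sq,
        Nat.factorial]
      push_cast
      ring
    rw [hsum] at h
    refine h.trans (mul_le_of_le_one_right (by positivity) ?_)
    norm_num [Nat.factorial]
  have hlarge : 1 < |x| →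
      ‖Complex.exp (x * Complex.I) - (1 + x * Complex.I - x ^ 2 / 2)‖ ≤ 4 * x ^ 2 := by
    intro hx
    have h1 : ‖(x : ℂ) ^ 2 / 2‖ = x ^ 2 / 2 := by simp
    have h2 : ‖(x * Complex.I : ℂ)‖ = |x| := by simp
    have h3 := norm_sub_le (Complex.exp (x * Complex.I)) (1 + x * Complex.I - x ^ 2 / 2)
    have h4 := norm_sub_le (1 + x * Complex.I : ℂ) (x ^ 2 / 2)
    have h5 := norm_add_le (1 : ℂ) (x * Complex.I)
    rw [Complex.norm_exp_ofReal_mul_I] at h3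
    rw [h1] at h4
    rw [h2, norm_one] at h5
    nlinarith [sq_abs x]
  have hpos : 0 ≤ ε ^ (-δ) * |x| ^ (2 + δ) := by positivity
  rcases le_or_gt |x| ε with h | h
  · refine (hsmall (h.trans hε1)).trans ?_
    have : |x| ^ 3 = |x| * x ^ 2 := by rw [← sq_abs x]; ring
    nlinarith [sq_nonneg x]
  · have htrunc := sq_le_rpow_of_lt_abs hε hδ h
    have hx2 : 0 ≤ ε * x ^ 2 := by positivity
    rcases le_or_gt |x| 1 with h1 | h1
    · have : |x| ^ 3 = |x| * x ^ 2 := by rw [← sq_abs x]; ring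
      nlinarith [sq_nonneg x, hsmall h1]
    · linarith [hlarge h1]

theorem abs_exp_neg_sub_one_sub_le {u : ℝ} (hu : 0 ≤ u) : |Real.exp (-u) - (1 - u)| ≤ u ^ 2 := by
  have h1 := Real.add_one_le_exp (-u)
  have h2 := Real.add_one_le_exp u
  have h3 : Real.exp (-u) * Real.exp u = 1 := by rw [← Real.exp_add]; simp
  have h4 : Real.exp (-u) ≤ 1 - u + u ^ 2 := by
    have h5 : Real.exp (-u) * (1 + u) ≤ 1 := by nlinarith [Real.exp_pos (-u)]
    have h6 : 1 ≤ (1 - u + u ^ 2) * (1 + u) := by nlinarith [pow_nonneg hu 3]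
    exact le_of_mul_le_mul_right (h5.trans h6) (by linarith)
  rw [abs_le]
  constructor <;> nlinarith [sq_nonneg u]

/-- The characteristic function at `1` of a centered variable `V` is close to that of the Gaussian
with the same variance, with an error given by the variance and a moment of order `2 + δ`. -/
theorem norm_integral_exp_sub_gaussian_le {Ω : Type*} [MeasurableSpace Ω] (P : Measure Ω)
    [IsProbabilityMeasure P] {V : Ω → ℝ} {δ ε : ℝ} (hδ : 0 < δ) (hε : 0 < ε) (hε1 : ε ≤ 1)
    (hV : MemLp V (ENNReal.ofReal (2 + δ)) P) (h0 : ∫ ω, V ω ∂P = 0) :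
    ‖∫ ω, Complex.exp (V ω * Complex.I) ∂P - Complex.exp (-((∫ ω, V ω ^ 2 ∂P : ℝ) : ℂ) / 2)‖ ≤
      ε * ∫ ω, V ω ^ 2 ∂P + 4 * (ε ^ (-δ) * ∫ ω, |V ω| ^ (2 + δ) ∂P) +
        (∫ ω, V ω ^ 2 ∂P) * (ε ^ 2 + ε ^ (-δ) * ∫ ω, |V ω| ^ (2 + δ) ∂P) := by
  have hVm : Integrable (fun ω => |V ω| ^ (2 + δ)) P := by
    have h := hV.integrable_norm_rpow (by simp; linarith) (by simp)
    rwa [ENNReal.toReal_ofReal (by linarith)] at h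
  have hV2 : MemLp V 2 P := hV.mono_exponent (by
    rw [← ENNReal.ofReal_ofNat 2]; exact ENNReal.ofReal_le_ofReal (by linarith))
  have hVsq : Integrable (fun ω => V ω ^ 2) P := hV2.integrable_sq
  have hV1 : Integrable V P := hV2.integrable (by norm_num)
  have hexp : Integrable (fun ω => Complex.exp (V ω * Complex.I)) P := by
    refine Integrable.of_bound (C := 1) ?_ (ae_of_all _ fun ω => ?_)
    · exact Complex.measurable_exp.comp_aemeasurable
        (by have := hV1.aemeasurable; fun_prop) |>.aestronglyMeasurable
    · rw [Complex.norm_exp_ofReal_mul_I]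
  set v := ∫ ω, V ω ^ 2 ∂P with hv
  set m := ∫ ω, |V ω| ^ (2 + δ) ∂P with hm
  have hv0 : 0 ≤ v := integral_nonneg fun ω => sq_nonneg _
  -- Bounds one factor of `v ^ 2`, the error of replacing `exp (-v / 2)` by `1 - v / 2`.
  have hvle : v ≤ ε ^ 2 + ε ^ (-δ) * m := by
    have h := integral_mono hVsq ((integrable_const (ε ^ 2)).add (hVm.const_mul (ε ^ (-δ))))
      fun ω => sq_le_sq_add_rpow (V ω) hε hδ
    simp only [Pi.add_apply] at h
    rwa [integral_add (integrable_const _) (hVm.const_mul _), integral_const_mul, integral_const,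
      probReal_univ, one_smul] at h
  have hVc : Integrable (fun ω => V ω * Complex.I) P := hV1.ofReal.mul_const _
  have hVsqc : Integrable (fun ω => (V ω : ℂ) ^ 2) P := by
    simpa using hVsq.ofReal (𝕜 := ℂ)
  have hVlin : Integrable (fun ω => 1 + V ω * Complex.I) P := (integrable_const 1).add hVc
  have hlin : Integrable (fun ω => 1 + V ω * Complex.I - (V ω : ℂ) ^ 2 / 2) P :=
    hVlin.sub (hVsqc.div_const 2)
  have htaylor : ∫ ω, (1 + V ω * Complex.I - (V ω : ℂ) ^ 2 / 2) ∂P = 1 - (v : ℂ) / 2 := by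
    have hsqc : ∫ ω, (V ω : ℂ) ^ 2 ∂P = v := by
      rw [hv, ← integral_complex_ofReal]
      simp
    rw [integral_sub hVlin (hVsqc.div_const 2), integral_add (integrable_const 1) hVc,
      integral_mul_const, integral_div, hsqc, integral_complex_ofReal, h0]
    simp
  have hA : ‖∫ ω, Complex.exp (V ω * Complex.I) ∂P - (1 - (v : ℂ) / 2)‖ ≤
      ε * v + 4 * (ε ^ (-δ) * m) := by
    rw [← htaylor, ← integral_sub hexp hlin]
    refine (norm_integral_le_integral_norm _).trans ?_
    have h := integral_mono (hexp.sub hlin).norm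
      ((hVsq.const_mul ε).add ((hVm.const_mul (ε ^ (-δ))).const_mul 4))
      fun ω => norm_exp_mul_I_sub_taylor_le (V ω) hε hε1 hδ
    simp only [Pi.add_apply, Pi.sub_apply] at h
    rwa [integral_add (hVsq.const_mul ε) ((hVm.const_mul _).const_mul 4), integral_const_mul,
      integral_const_mul, integral_const_mul] at h
  have hB : ‖(1 - (v : ℂ) / 2) - Complex.exp (-(v : ℂ) / 2)‖ ≤ v * (ε ^ 2 + ε ^ (-δ) * m) := by
    have h := abs_exp_neg_sub_one_sub_le (u := v / 2) (by positivity)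
    have e : (1 - (v : ℂ) / 2) - Complex.exp (-(v : ℂ) / 2) =
        -((Real.exp (-(v / 2)) - (1 - v / 2) : ℝ) : ℂ) := by
      push_cast
      rw [neg_div]
      ring
    rw [e, norm_neg, Complex.norm_real, Real.norm_eq_abs]
    nlinarith
  exact (norm_sub_le_norm_sub_add_norm_sub _ _ _).trans (add_le_add hA hB)

/-- Lyapunov's central limit theorem in quantitative form, for the characteristic function at `1` of
the sum of independent centered variables `V i` with total variance `s`. -/
theorem norm_integral_exp_sum_sub_gaussian_le {ι : Type*} [Fintype ι] (ν : ι → Measure ℝ)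
    [∀ i, IsProbabilityMeasure (ν i)] {V : ι → ℝ → ℝ} {δ ε s L : ℝ} (hδ : 0 < δ) (hε : 0 < ε)
    (hε1 : ε ≤ 1) (hV : ∀ i, MemLp (V i) (ENNReal.ofReal (2 + δ)) (ν i))
    (h0 : ∀ i, ∫ y, V i y ∂(ν i) = 0) (hs : ∑ i, ∫ y, V i y ^ 2 ∂(ν i) = s)
    (hL : ∑ i, ∫ y, |V i y| ^ (2 + δ) ∂(ν i) ≤ L) :
    ‖∫ y, Complex.exp (((∑ i, V i (y i) : ℝ) : ℂ) * Complex.I) ∂(Measure.pi ν) -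
        Complex.exp (-(s : ℂ) / 2)‖ ≤
      2 * s * ε + (4 + s) * ε ^ (-δ) * L := by
  have hprod : ∫ y, Complex.exp (((∑ i, V i (y i) : ℝ) : ℂ) * Complex.I) ∂(Measure.pi ν) =
      ∏ i, ∫ y, Complex.exp (V i y * Complex.I) ∂(ν i) := by
    rw [← integral_fintype_prod_eq_prod (f := fun i y => Complex.exp (V i y * Complex.I))]
    simp_rw [← Complex.exp_sum]
    push_cast
    simp_rw [Finset.sum_mul]
  have hgauss : Complex.exp (-(s : ℂ) / 2) =
      ∏ i, Complex.exp (-((∫ y, V i y ^ 2 ∂(ν i) : ℝ) : ℂ) / 2) := by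
    rw [← Complex.exp_sum, ← hs, ← Finset.sum_div, Finset.sum_neg_distrib]
    push_cast
    rfl
  have hv0 : ∀ i, 0 ≤ ∫ y, V i y ^ 2 ∂(ν i) := fun i => integral_nonneg fun _ => sq_nonneg _
  have hm0 : ∀ i, 0 ≤ ∫ y, |V i y| ^ (2 + δ) ∂(ν i) := fun i => integral_nonneg fun _ => by
    positivity
  have hs0 : 0 ≤ s := hs ▸ Finset.sum_nonneg fun i _ => hv0 i
  rw [hprod, hgauss]
  refine (norm_prod_sub_prod_le_sum _ _ _ (fun i => ?_) fun i => ?_).trans ?_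
  · refine (norm_integral_le_integral_norm _).trans ?_
    simp_rw [Complex.norm_exp_ofReal_mul_I]
    simp
  · rw [Complex.norm_exp, Real.exp_le_one_iff]
    have := hv0 i
    rw [← Complex.ofReal_neg, ← Complex.ofReal_ofNat, ← Complex.ofReal_div, Complex.ofReal_re]
    linarith
  have hεδ : 0 < ε ^ (-δ) := by positivity
  calc ∑ i, ‖∫ y, Complex.exp (V i y * Complex.I) ∂(ν i) -
          Complex.exp (-((∫ y, V i y ^ 2 ∂(ν i) : ℝ) : ℂ) / 2)‖
      ≤ ∑ i, ((ε * ∫ y, V i y ^ 2 ∂(ν i)) + 4 * (ε ^ (-δ) * ∫ y, |V i y| ^ (2 + δ) ∂(ν i)) +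
          (∫ y, V i y ^ 2 ∂(ν i)) * (ε + ε ^ (-δ) * L)) := by
        refine Finset.sum_le_sum fun i _ =>
          (norm_integral_exp_sub_gaussian_le (ν i) hδ hε hε1 (hV i) (h0 i)).trans ?_
        have hmL : ∫ y, |V i y| ^ (2 + δ) ∂(ν i) ≤ L :=
          (Finset.single_le_sum (f := fun i => ∫ y, |V i y| ^ (2 + δ) ∂(ν i))
            (fun i _ => hm0 i) (Finset.mem_univ i)).trans hL
        have hsq : ε ^ 2 ≤ ε := by nlinarith
        gcongr
    _ = ε * s + 4 * (ε ^ (-δ) * ∑ i, ∫ y, |V i y| ^ (2 + δ) ∂(ν i)) +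
          s * (ε + ε ^ (-δ) * L) := by
        rw [Finset.sum_add_distrib, Finset.sum_add_distrib, ← Finset.mul_sum, ← Finset.mul_sum,
          ← Finset.mul_sum, ← Finset.sum_mul, hs]
    _ ≤ ε * s + 4 * (ε ^ (-δ) * L) + s * (ε + ε ^ (-δ) * L) := by gcongr
    _ = 2 * s * ε + (4 + s) * ε ^ (-δ) * L := by ring

/-- Letting the Lyapunov ratio tend to zero first and the truncation level second. -/
theorem tendsto_of_forall_norm_sub_le {u : ℕ → ℂ} {a : ℂ} {L : ℕ → ℝ} {s δ : ℝ} (hs : 0 ≤ s)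
    (hL : Tendsto L atTop (𝓝 0))
    (h : ∀ᶠ n in atTop, ∀ ε : ℝ, 0 < ε → ε ≤ 1 →
      ‖u n - a‖ ≤ 2 * s * ε + (4 + s) * ε ^ (-δ) * L n) :
    Tendsto u atTop (𝓝 a) := by
  rw [Metric.tendsto_nhds]
  intro η hη
  set ε := min 1 (η / (4 * (s + 1))) with hεdef
  have hε : 0 < ε := lt_min one_pos (by positivity)
  have hε2 : 2 * s * ε ≤ η / 2 := by
    have h1 : ε * (4 * (s + 1)) ≤ η := (le_div_iff₀ (by positivity)).1 (min_le_right _ _)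
    nlinarith
  have hlim : Tendsto (fun n => (4 + s) * ε ^ (-δ) * L n) atTop (𝓝 0) := by
    simpa using hL.const_mul ((4 + s) * ε ^ (-δ))
  filter_upwards [h, hlim.eventually_lt_const (half_pos hη)] with n hn hLn
  rw [dist_eq_norm]
  linarith [hn ε hε (min_le_left _ _)]

/-! ### Positive definite matrices -/

namespace Study

theorem dotProduct_mulVec_comm {m : ℕ} {A : Matrix (Fin m) (Fin m) ℝ} (hA : A.IsHermitian)
    (x y : Fin m → ℝ) : x ⬝ᵥ (A *ᵥ y) = (A *ᵥ x) ⬝ᵥ y := by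
  have h : Aᵀ = A := by simpa using hA.eq
  rw [Matrix.dotProduct_mulVec, ← Matrix.mulVec_transpose, h]

/-- The Rayleigh quotient is at least the smallest eigenvalue. -/
theorem mul_dotProduct_le_of_le_lambdaMin {m : ℕ} {A : Matrix (Fin m) (Fin m) ℝ}
    (hA : A.IsHermitian) {c : ℝ} (hc : c ≤ lambdaMin A) (b : Fin m → ℝ) :
    c * (b ⬝ᵥ b) ≤ b ⬝ᵥ (A *ᵥ b) := by
  open scoped MatrixOrder in
  have h : algebraMap ℝ (Matrix (Fin m) (Fin m) ℝ) c ≤ A := by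
    refine (algebraMap_le_iff_le_spectrum hA.isSelfAdjoint).2 fun x hx => ?_
    exact hc.trans (csInf_le A.finite_real_spectrum.bddBelow hx)
  have h2 := (Matrix.le_iff.1 h).dotProduct_mulVec_nonneg b
  rw [Matrix.sub_mulVec, dotProduct_sub, Algebra.algebraMap_eq_smul_one, Matrix.smul_mulVec,
    Matrix.one_mulVec, dotProduct_smul, star_trivial, smul_eq_mul] at h2
  linarith

theorem posDef_of_le_lambdaMin {m : ℕ} {A : Matrix (Fin m) (Fin m) ℝ} (hA : A.IsHermitian) {c : ℝ}
    (hc : 0 < c) (hcA : c ≤ lambdaMin A) : A.PosDef := by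
  refine Matrix.PosDef.of_dotProduct_mulVec_pos hA fun x hx => ?_
  rw [star_trivial]
  have h1 : 0 < x ⬝ᵥ x := by simpa using Matrix.dotProduct_star_self_pos_iff.2 hx
  exact (mul_pos hc h1).trans_le (mul_dotProduct_le_of_le_lambdaMin hA hcA x)

/-- No assumption on `A` is needed: the functional calculus is `0` off its domain. -/
theorem isHermitian_invSqrt {m : ℕ} (A : Matrix (Fin m) (Fin m) ℝ) : (invSqrt A).IsHermitian :=
  (cfc_predicate (p := IsSelfAdjoint) (fun t : ℝ => (Real.sqrt t)⁻¹) A)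

theorem invSqrt_mul_mul_invSqrt {m : ℕ} {A : Matrix (Fin m) (Fin m) ℝ} (hA : A.PosDef) :
    invSqrt A * A * invSqrt A = 1 := by
  have hsa : IsSelfAdjoint A := hA.isHermitian.isSelfAdjoint
  -- The spectrum is finite, so every function is continuous on it.
  have hfin := A.finite_real_spectrum (𝕜 := ℝ)
  have hc : ∀ f : ℝ → ℝ, ContinuousOn f (spectrum ℝ A) := fun f => hfin.continuousOn f
  nth_rw 2 [← cfc_id ℝ A]
  unfold invSqrt
  rw [← cfc_mul _ _ A (hc _) (hc _), ← cfc_mul _ _ A (hc _) (hc _), ← cfc_one ℝ A]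
  refine cfc_congr fun t ht => ?_
  obtain ⟨i, rfl⟩ := hA.isHermitian.spectrum_real_eq_range_eigenvalues ▸ ht
  have hpos := hA.eigenvalues_pos i
  have := Real.sq_sqrt hpos.le
  have h0 := (Real.sqrt_pos.2 hpos).ne'
  simp only [id, Pi.one_apply]
  field_simp
  exact this.symm

end Study

/-! ### The normalized error as a sum of independent terms -/

namespace Study

variable {p q n : ℕ}

theorem isHermitian_outerSq {m : ℕ} (z : EuclideanSpace ℝ (Fin m)) : (outerSq z).IsHermitian := by
  ext i j
  simp [outerSq, Matrix.vecMulVec_apply, mul_comm]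

theorem dotProduct_outerSq_mulVec {m : ℕ} (z : EuclideanSpace ℝ (Fin m)) (b : Fin m → ℝ) :
    b ⬝ᵥ (outerSq z *ᵥ b) = (WithLp.ofLp z ⬝ᵥ b) ^ 2 := by
  rw [outerSq, Matrix.vecMulVec_mulVec, op_smul_eq_smul, dotProduct_smul, smul_eq_mul,
    dotProduct_comm b, sq]

theorem isHermitian_gammaStar (E : Study p q n) (w : Design p n) : (E.gammaStar w).IsHermitian := by
  unfold gammaStar
  exact (IsSelfAdjoint.all _).smul
    (isSelfAdjoint_sum _ fun i _ => (isHermitian_outerSq _).isSelfAdjoint)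

theorem isHermitian_deltaStar (E : Study p q n) (w : Design p n) : (E.deltaStar w).IsHermitian := by
  unfold deltaStar
  exact (IsSelfAdjoint.all _).smul (isSelfAdjoint_sum _ fun i _ =>
    (IsSelfAdjoint.all _).smul (isHermitian_outerSq _).isSelfAdjoint)

theorem posDef_sigmaStar (E : Study p q n) (w : Design p n) (hG : (E.gammaStar w).PosDef)
    (hD : (E.deltaStar w).PosDef) : (E.sigmaStar w).PosDef := by
  have h := hD.conjTranspose_mul_mul_same (B := (E.gammaStar w)⁻¹)
    (Matrix.mulVec_injective_of_isUnit hG.inv.isUnit)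
  rwa [hG.inv.isHermitian.eq] at h

/-- The direction `Γ*⁻¹ Σ*^{-1/2} t` onto which the scores `Zᵢ Uᵢ` are projected in the component of
the normalized error along `t`. -/
noncomputable def scoreDirection (E : Study p q n) (w : Design p n) (t : EuclideanSpace ℝ (Fin (q + 2))) :
    Fin (q + 2) → ℝ :=
  (E.gammaStar w)⁻¹ *ᵥ (invSqrt (E.sigmaStar w) *ᵥ WithLp.ofLp t)

/-- The weight of the residual of unit `i` in the component of the normalized error along `t`; it
vanishes off the subsample. -/
noncomputable def scoreWeight (E : Study p q n) (w : Design p n) (t : EuclideanSpace ℝ (Fin (q + 2)))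
    (i : Fin n) : ℝ :=
  open scoped Classical in
  if i ∈ E.subsample w then
    (√((E.subsample w).card : ℝ))⁻¹ *
      (WithLp.ofLp (E.regressors w (w i)) ⬝ᵥ E.scoreDirection w t)
  else 0

/-- The normalized error is standardized: the projected scores have variance `‖t‖ ^ 2`. -/
theorem scoreDirection_dotProduct_deltaStar (E : Study p q n) (w : Design p n)
    (t : EuclideanSpace ℝ (Fin (q + 2))) (hG : (E.gammaStar w).PosDef)
    (hD : (E.deltaStar w).PosDef) :
    E.scoreDirection w t ⬝ᵥ (E.deltaStar w *ᵥ E.scoreDirection w t) = ‖t‖ ^ 2 := by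
  have h := invSqrt_mul_mul_invSqrt (E.posDef_sigmaStar w hG hD)
  nth_rw 2 [sigmaStar] at h
  simp only [← mul_assoc] at h
  unfold scoreDirection
  rw [← dotProduct_mulVec_comm hG.inv.isHermitian, ← dotProduct_mulVec_comm (isHermitian_invSqrt _),
    Matrix.mulVec_mulVec, Matrix.mulVec_mulVec, Matrix.mulVec_mulVec, Matrix.mulVec_mulVec,
    h, Matrix.one_mulVec,
    EuclideanSpace.real_norm_sq_eq]
  simp [dotProduct, sq]

theorem norm_scoreDirection_sq_le (E : Study p q n) (w : Design p n)
    (t : EuclideanSpace ℝ (Fin (q + 2))) (hG : (E.gammaStar w).PosDef)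
    {c : ℝ} (hc : 0 < c) (hD : c ≤ lambdaMin (E.deltaStar w)) :
    ‖WithLp.toLp 2 (E.scoreDirection w t)‖ ^ 2 ≤ ‖t‖ ^ 2 / c := by
  have hDh := E.isHermitian_deltaStar w
  rw [le_div_iff₀' hc, ← E.scoreDirection_dotProduct_deltaStar w t hG
    (posDef_of_le_lambdaMin hDh hc hD)]
  refine le_trans (le_of_eq ?_) (mul_dotProduct_le_of_le_lambdaMin hDh hD _)
  rw [EuclideanSpace.real_norm_sq_eq]
  simp [dotProduct, sq]

theorem thetaHat_sub_thetaF (E : Study p q n) (w : Design p n) (y : Fin n → ℝ) :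
    E.thetaHat w y - E.thetaF w = E.leastSquares w fun i => y i - E.condMean w (w i) := by
  simp only [thetaHat, thetaF, leastSquares, ← Matrix.mulVec_sub, ← smul_sub,
    ← Finset.sum_sub_distrib, ← sub_smul]

theorem inner_normalizedError (E : Study p q n) (w : Design p n) (y : Fin n → ℝ)
    (t : EuclideanSpace ℝ (Fin (q + 2))) :
    inner ℝ (E.normalizedError w y) t =
      ∑ i, E.scoreWeight w t i * (y i - E.condMean w (w i)) := by
  classical
  have hm : √((E.subsample w).card : ℝ) * ((E.subsample w).card : ℝ)⁻¹ =
      (√((E.subsample w).card : ℝ))⁻¹ := by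
    rw [← Real.sqrt_div_self, div_eq_mul_inv]
  rw [EuclideanSpace.inner_eq_star_dotProduct, star_trivial, normalizedError, thetaHat_sub_thetaF,
    leastSquares, ← Matrix.mulVec_smul, smul_smul, hm,
    dotProduct_mulVec_comm (isHermitian_invSqrt _),
    dotProduct_mulVec_comm (E.isHermitian_gammaStar w).inv, ← scoreDirection, dotProduct_smul,
    dotProduct_sum, smul_eq_mul, Finset.mul_sum]
  simp only [scoreWeight, ite_mul, zero_mul, Finset.sum_ite_mem, Finset.univ_inter]
  refine Finset.sum_congr rfl fun i _ => ?_
  rw [dotProduct_smul, smul_eq_mul, dotProduct_comm]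
  ring

theorem sum_scoreWeight_sq_mul_condVar (E : Study p q n) (w : Design p n)
    (t : EuclideanSpace ℝ (Fin (q + 2))) :
    ∑ i, E.scoreWeight w t i ^ 2 * E.condVar w (w i) =
      E.scoreDirection w t ⬝ᵥ (E.deltaStar w *ᵥ E.scoreDirection w t) := by
  classical
  rw [deltaStar, Matrix.smul_mulVec, dotProduct_smul, Matrix.sum_mulVec, dotProduct_sum,
    smul_eq_mul, Finset.mul_sum]
  simp only [scoreWeight, ite_pow, ite_mul, zero_mul, ne_eq, OfNat.ofNat_ne_zero,
    not_false_eq_true, zero_pow, Finset.sum_ite_mem, Finset.univ_inter]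
  refine Finset.sum_congr rfl fun i _ => ?_
  rw [Matrix.smul_mulVec, dotProduct_smul, dotProduct_outerSq_mulVec, mul_pow, inv_pow,
    Real.sq_sqrt (Nat.cast_nonneg _), smul_eq_mul]
  ring

/-! ### Moments of the residuals -/

theorem one_le_norm_regressors (E : Study p q n) (w : Design p n) (c : UnitDesign p) :
    1 ≤ ‖E.regressors w c‖ := by
  have h := PiLp.norm_apply_le (E.regressors w c) 0
  simpa [regressors] using h

theorem memLp_smul_regressors (E : Study p q n) (w : Design p n) (c : UnitDesign p) {δ M : ℝ}
    (hδ : 0 < δ) (hM : E.condMoment (2 + δ) w c ≤ ENNReal.ofReal M) :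
    MemLp (fun y => (y - E.condMean w c) • E.regressors w c) (ENNReal.ofReal (2 + δ))
      (E.F (w, c)) := by
  have hmeas : Measurable fun y : ℝ => (y - E.condMean w c) • E.regressors w c := by fun_prop
  refine ⟨hmeas.aestronglyMeasurable, ?_⟩
  rw [eLpNorm_lt_top_iff_lintegral_rpow_enorm_lt_top (by simp; linarith) (by simp),
    ENNReal.toReal_ofReal (by linarith)]
  exact hM.trans_lt ENNReal.ofReal_lt_top

theorem memLp_sub_condMean (E : Study p q n) (w : Design p n) (c : UnitDesign p) {δ M : ℝ}
    (hδ : 0 < δ) (hM : E.condMoment (2 + δ) w c ≤ ENNReal.ofReal M) :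
    MemLp (fun y => y - E.condMean w c) (ENNReal.ofReal (2 + δ)) (E.F (w, c)) := by
  refine (E.memLp_smul_regressors w c hδ hM).mono (by fun_prop) (ae_of_all _ fun y => ?_)
  rw [norm_smul]
  exact le_mul_of_one_le_right (norm_nonneg _) (E.one_le_norm_regressors w c)

/-- The moment bound makes `Y` conditionally integrable, so that `condMean` is a genuine mean and the
residual is centered. -/
theorem integral_sub_condMean (E : Study p q n) (w : Design p n) (c : UnitDesign p) {δ M : ℝ}
    (hδ : 0 < δ) (hM : E.condMoment (2 + δ) w c ≤ ENNReal.ofReal M) :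
    ∫ y, (y - E.condMean w c) ∂(E.F (w, c)) = 0 := by
  have h1 : Integrable (fun y => y - E.condMean w c) (E.F (w, c)) :=
    (E.memLp_sub_condMean w c hδ hM).integrable (by
      rw [← ENNReal.ofReal_one]; exact ENNReal.ofReal_le_ofReal (by linarith))
  have h2 : Integrable (fun y : ℝ => y) (E.F (w, c)) := by
    refine (h1.add (integrable_const (E.condMean w c))).congr (ae_of_all _ fun y => ?_)
    simp
  rw [integral_sub h2 (integrable_const _), integral_const, probReal_univ, one_smul, condMean,
    sub_self]

theorem integral_norm_smul_regressors_rpow_le (E : Study p q n) (w : Design p n)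
    (c : UnitDesign p) {δ M : ℝ} (hδ : 0 < δ) (hM0 : 0 ≤ M)
    (hM : E.condMoment (2 + δ) w c ≤ ENNReal.ofReal M) :
    ∫ y, ‖(y - E.condMean w c) • E.regressors w c‖ ^ (2 + δ) ∂(E.F (w, c)) ≤ M := by
  have hmeas : Measurable fun y : ℝ => (y - E.condMean w c) • E.regressors w c := by fun_prop
  rw [integral_eq_lintegral_of_nonneg_ae (ae_of_all _ fun _ => by positivity)
    (hmeas.norm.pow_const _).aestronglyMeasurable]
  refine ENNReal.toReal_le_of_le_ofReal hM0 (le_trans (le_of_eq ?_) hM)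
  refine lintegral_congr fun y => ?_
  rw [← ENNReal.ofReal_rpow_of_nonneg (norm_nonneg _) (by linarith), ofReal_norm]

/-- The Lyapunov sum of the projected scores, bounded through `‖Zᵢ Uᵢ‖`. -/
theorem sum_integral_abs_rpow_le (E : Study p q n) (w : Design p n)
    (t : EuclideanSpace ℝ (Fin (q + 2))) {δ M : ℝ} (hδ : 0 < δ) (hM0 : 0 ≤ M)
    (hcard : 0 < (E.subsample w).card)
    (hM : ∀ i ∈ E.subsample w, E.condMoment (2 + δ) w (w i) ≤ ENNReal.ofReal M) :
    ∑ i, ∫ y, |E.scoreWeight w t i * (y - E.condMean w (w i))| ^ (2 + δ) ∂(E.F (w, w i)) ≤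
      ‖WithLp.toLp 2 (E.scoreDirection w t)‖ ^ (2 + δ) * M *
        (√((E.subsample w).card : ℝ)) ^ (-δ) := by
  classical
  set b := E.scoreDirection w t with hb
  set r := √((E.subsample w).card : ℝ) with hr
  have hr0 : 0 < r := Real.sqrt_pos.2 (by exact_mod_cast hcard)
  have hoff : ∀ i ∉ E.subsample w,
      ∫ y, |E.scoreWeight w t i * (y - E.condMean w (w i))| ^ (2 + δ) ∂(E.F (w, w i)) = 0 := by
    intro i hi
    simp [scoreWeight, hi, Real.zero_rpow (by linarith : (2 + δ) ≠ 0)]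
  have hon : ∀ i ∈ E.subsample w,
      ∫ y, |E.scoreWeight w t i * (y - E.condMean w (w i))| ^ (2 + δ) ∂(E.F (w, w i)) ≤
        (r⁻¹ * ‖WithLp.toLp 2 b‖) ^ (2 + δ) * M := by
    intro i hi
    have hint := (E.memLp_smul_regressors w (w i) hδ (hM i hi)).integrable_norm_rpow
      (by simp; linarith) (by simp)
    rw [ENNReal.toReal_ofReal (by linarith)] at hint
    refine (integral_mono_of_nonneg (ae_of_all _ fun _ => by positivity)
      (hint.const_mul ((r⁻¹ * ‖WithLp.toLp 2 b‖) ^ (2 + δ))) (ae_of_all _ fun y => ?_)).trans ?_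
    · dsimp only
      rw [← Real.mul_rpow (by positivity) (norm_nonneg _)]
      refine Real.rpow_le_rpow (abs_nonneg _) ?_ (by linarith)
      have hcs := abs_real_inner_le_norm (WithLp.toLp 2 b) (E.regressors w (w i))
      rw [EuclideanSpace.inner_eq_star_dotProduct, star_trivial] at hcs
      rw [scoreWeight, if_pos hi, abs_mul, abs_mul, norm_smul, Real.norm_eq_abs, ← hr, ← hb,
        abs_of_pos (inv_pos.2 hr0)]
      calc r⁻¹ * |WithLp.ofLp (E.regressors w (w i)) ⬝ᵥ b| * |y - E.condMean w (w i)|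
          ≤ r⁻¹ * (‖WithLp.toLp 2 b‖ * ‖E.regressors w (w i)‖) * |y - E.condMean w (w i)| := by
            gcongr
        _ = _ := by ring
    · rw [integral_const_mul]
      gcongr
      exact E.integral_norm_smul_regressors_rpow_le w (w i) hδ hM0 (hM i hi)
  rw [← Finset.sum_subset (Finset.subset_univ (E.subsample w)) fun i _ hi => hoff i hi]
  refine (Finset.sum_le_card_nsmul _ _ _ hon).trans (le_of_eq ?_)
  -- The `r ^ 2 = |S*|` equal bounds carry the factor `r ^ (-(2 + δ))`, which leaves `r ^ (-δ)`.
  have hcast : ((E.subsample w).card : ℝ) = r ^ 2 := (Real.sq_sqrt (Nat.cast_nonneg _)).symm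
  have hpow : r ^ 2 * (r⁻¹) ^ (2 + δ) = r ^ (-δ) := by
    rw [Real.inv_rpow hr0.le, ← Real.rpow_neg hr0.le, ← Real.rpow_two, ← Real.rpow_add hr0]
    congr 1
    ring
  rw [nsmul_eq_mul, hcast, Real.mul_rpow (inv_nonneg.2 hr0.le) (norm_nonneg _), ← hpow]
  ring

/-! ### Convergence of the conditional law -/

theorem measurable_normalizedError (E : Study p q n) (w : Design p n) :
    Measurable (E.normalizedError w) := by
  unfold normalizedError thetaHat leastSquares
  have hv : Continuous fun y : Fin n → ℝ =>
      ∑ i ∈ E.subsample w, y i • WithLp.ofLp (E.regressors w (w i)) := by fun_prop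
  refine Continuous.measurable ?_
  refine (PiLp.continuous_toLp 2 _).comp (Continuous.matrix_mulVec continuous_const ?_)
  exact ((Continuous.matrix_mulVec continuous_const
    (hv.const_smul ((E.subsample w).card : ℝ)⁻¹)).sub continuous_const).const_smul
      √((E.subsample w).card : ℝ)

instance instIsProbabilityMeasureCondLaw (E : Study p q n) (w : Design p n) :
    IsProbabilityMeasure (E.condLaw E.normalizedError w) :=
  Measure.isProbabilityMeasure_map (E.measurable_normalizedError w).aemeasurable

/-- The characteristic function of the conditional law is close to the standard Gaussian one, with
an error that vanishes as the subsample grows. -/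
theorem norm_charFun_condLaw_sub_le (E : Study p q n) (w : Design p n)
    (t : EuclideanSpace ℝ (Fin (q + 2))) {δ M c ε : ℝ} (hδ : 0 < δ) (hM0 : 0 ≤ M) (hc : 0 < c)
    (hε : 0 < ε) (hε1 : ε ≤ 1) (hcard : 0 < (E.subsample w).card)
    (hG : (E.gammaStar w).PosDef) (hD : c ≤ lambdaMin (E.deltaStar w))
    (hM : ∀ i ∈ E.subsample w, E.condMoment (2 + δ) w (w i) ≤ ENNReal.ofReal M) :
    ‖charFun (E.condLaw E.normalizedError w) t - Complex.exp (-((‖t‖ ^ 2 : ℝ) : ℂ) / 2)‖ ≤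
      2 * ‖t‖ ^ 2 * ε + (4 + ‖t‖ ^ 2) * ε ^ (-δ) *
        ((√(‖t‖ ^ 2 / c)) ^ (2 + δ) * M * (√((E.subsample w).card : ℝ)) ^ (-δ)) := by
  have hDp := posDef_of_le_lambdaMin (E.isHermitian_deltaStar w) hc hD
  have hchar : charFun (E.condLaw E.normalizedError w) t =
      ∫ y, Complex.exp (((∑ i, E.scoreWeight w t i * (y i - E.condMean w (w i)) : ℝ) : ℂ) *
        Complex.I) ∂(Measure.pi fun i => E.F (w, w i)) := by
    rw [charFun_apply, condLaw, integral_map (E.measurable_normalizedError w).aemeasurable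
      (by fun_prop)]
    simp_rw [inner_normalizedError]
    rfl
  -- Off the subsample no moment is assumed, but there the terms of the sum vanish.
  have hzero : ∀ i ∉ E.subsample w, E.scoreWeight w t i = 0 := fun i hi => by
    simp [scoreWeight, hi]
  rw [hchar]
  refine norm_integral_exp_sum_sub_gaussian_le (fun i => E.F (w, w i))
    (V := fun i y => E.scoreWeight w t i * (y - E.condMean w (w i))) hδ hε hε1 (fun i => ?_)
    (fun i => ?_) ?_ ?_
  · by_cases hi : i ∈ E.subsample w
    · exact (E.memLp_sub_condMean w (w i) hδ (hM i hi)).const_mul _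
    · simp [hzero i hi]
  · by_cases hi : i ∈ E.subsample w
    · rw [integral_const_mul, E.integral_sub_condMean w (w i) hδ (hM i hi), mul_zero]
    · simp [hzero i hi]
  · simp_rw [mul_pow, integral_const_mul]
    exact (E.sum_scoreWeight_sq_mul_condVar w t).trans
      (E.scoreDirection_dotProduct_deltaStar w t hG hDp)
  · refine (E.sum_integral_abs_rpow_le w t hδ hM0 hcard hM).trans ?_
    have hle := Real.le_sqrt_of_sq_le (E.norm_scoreDirection_sq_le w t hG hc hD)
    gcongr

end Study

/-! ### Limits -/

theorem eventually_le_of_lt_ereal_liminf {u : ℕ → ℝ} {c lam : ℝ} (hc : c < lam)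
    (h : (lam : EReal) ≤ liminf (fun n => (u n : EReal)) atTop) : ∀ᶠ n in atTop, c ≤ u n := by
  have h1 : (c : EReal) < liminf (fun n => (u n : EReal)) atTop :=
    (EReal.coe_lt_coe_iff.2 hc).trans_le h
  filter_upwards [eventually_lt_of_lt_liminf h1] with n hn
  exact (EReal.coe_lt_coe_iff.1 hn).le

/-- Lévy's continuity theorem for the Lévy–Prokhorov distance. -/
theorem tendsto_levyProkhorovDist_of_tendsto_charFun {V : Type*} [NormedAddCommGroup V]
    [InnerProductSpace ℝ V] [FiniteDimensional ℝ V] [MeasurableSpace V] [BorelSpace V]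
    (μ : ℕ → Measure V) [∀ n, IsProbabilityMeasure (μ n)] (ν : Measure V) [IsProbabilityMeasure ν]
    (h : ∀ t, Tendsto (fun n => charFun (μ n) t) atTop (𝓝 (charFun ν t))) :
    Tendsto (fun n => levyProkhorovDist (μ n) ν) atTop (𝓝 0) := by
  let μ' : ℕ → ProbabilityMeasure V := fun n => ⟨μ n, inferInstance⟩
  let ν' : ProbabilityMeasure V := ⟨ν, inferInstance⟩
  have h1 : Tendsto μ' atTop (𝓝 ν') := ProbabilityMeasure.tendsto_iff_tendsto_charFun.2 h
  have h2 := (LevyProkhorov.continuous_ofMeasure_probabilityMeasure.tendsto _).comp h1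
  exact tendsto_iff_dist_tendsto_zero.1 h2

theorem proposition3 (p q : ℕ)
    -- for each sample size `n`, the sample and its analysis, and the realized design
    (E : (n : ℕ) → Study p q n) (w : (n : ℕ) → Design p n)
    -- the size of the subsample tends to infinity
    (hlarge : Tendsto (fun n => ((E n).subsample (w n)).card) atTop atTop)
    -- the smallest eigenvalues of `Γ*` and `Δ*` are asymptotically bounded away from zero
    (hGam : ∃ lam : ℝ, 0 < lam ∧
      (lam : EReal) ≤ liminf (fun n => (Study.lambdaMin ((E n).gammaStar (w n)) : EReal)) atTop)
    (hDel : ∃ lam : ℝ, 0 < lam ∧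
      (lam : EReal) ≤ liminf (fun n => (Study.lambdaMin ((E n).deltaStar (w n)) : EReal)) atTop)
    -- moments of order `2 + δ` are bounded uniformly over the subsample and the sample size
    (δ : ℝ) (hδ : 0 < δ)
    (hmoment : ∃ M : ℝ, 0 < M ∧ ∀ d : Fin 2, ∀ n : ℕ, ∀ x ∈ (E n).subsampleSupport (w n) d,
      (E n).condMoment (2 + δ) (w n) (x, d) ≤ ENNReal.ofReal M) :
    Tendsto
      (fun n => levyProkhorovDist ((E n).condLaw (E n).normalizedError (w n))
        (multivariateGaussian (0 : EuclideanSpace ℝ (Fin (q + 2))) 1))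
      atTop (𝓝 0) := by
  obtain ⟨lamG, hlamG, hGam⟩ := hGam
  obtain ⟨lamD, hlamD, hDel⟩ := hDel
  obtain ⟨M, hM, hmoment⟩ := hmoment
  refine tendsto_levyProkhorovDist_of_tendsto_charFun
    (fun n => (E n).condLaw (E n).normalizedError (w n)) _ fun t => ?_
  have hgauss : charFun (multivariateGaussian (0 : EuclideanSpace ℝ (Fin (q + 2))) 1) t =
      Complex.exp (-((‖t‖ ^ 2 : ℝ) : ℂ) / 2) := by
    rw [multivariateGaussian_zero_one, charFun_stdGaussian]
    push_cast
    rfl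
  rw [hgauss]
  have hcardR : Tendsto (fun n => √(((E n).subsample (w n)).card : ℝ)) atTop atTop :=
    Real.tendsto_sqrt_atTop.comp (tendsto_natCast_atTop_atTop.comp hlarge)
  have hL : Tendsto (fun n => (√(‖t‖ ^ 2 / (lamD / 2))) ^ (2 + δ) * M *
      (√(((E n).subsample (w n)).card : ℝ)) ^ (-δ)) atTop (𝓝 0) := by
    have h := ((tendsto_rpow_neg_atTop hδ).comp hcardR).const_mul
      ((√(‖t‖ ^ 2 / (lamD / 2))) ^ (2 + δ) * M)
    rwa [mul_zero] at h
  refine tendsto_of_forall_norm_sub_le (s := ‖t‖ ^ 2) (δ := δ) (by positivity) hL ?_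
  filter_upwards [hlarge.eventually_gt_atTop 0,
    eventually_le_of_lt_ereal_liminf (half_lt_self hlamG) hGam,
    eventually_le_of_lt_ereal_liminf (half_lt_self hlamD) hDel] with n hcard hG hD
  intro ε hε hε1
  exact (E n).norm_charFun_condLaw_sub_le (w n) t hδ hM.le (half_pos hlamD) hε hε1 hcard
    (Study.posDef_of_le_lambdaMin ((E n).isHermitian_gammaStar (w n)) (half_pos hlamG) hG) hD
    fun i hi => hmoment (w n i).2 n (w n i).1 ⟨i, hi, rfl, rfl⟩
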